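/- **Conventions.** Let $\mathcal H\neq\{0\}$ and $\mathcal K$ be finite-dimensional complex Hilbert spaces, let $\mathcal B(\mathcal H)$ be the space of linear operators on $\mathcal H$, and let $\mathcal C(\mathcal H,\mathcal K)$ be the convex set of quantum channels, that is, of completely positive trace preserving linear maps $\mathcal B(\mathcal H)\to\mathcal B(\mathcal K)$, with the metric given by the diamond norm $$\|\mathcal N\|_\lozenge=\sup_{k\in\mathbb N}\ \max\{\|(\mathrm{id}_k\otimes\mathcal N)(a)\|_1 : a\in\mathcal B(\mathbb C^k\otimes\mathcal H),\ \|a\|_1=1\}.$$ The relative interior $\mathrm{ri}\,\mathcal C(\mathcal H,\mathcal K)$ is the interior of $\mathcal C(\mathcal H,\mathcal K)$ in its (real) affine hull. *Confusability graph.* For a channel $\mathcal N(\cdot)=\sum_j E_j(\cdot)E_j^*$ let $S(\mathcal N)=\mathrm{span}\{E_j^*E_i\}_{i,j}\subseteq\mathcal B(\mathcal H)$, which does not depend on the choice of the Kraus operators $E_j$. *Quantum Lovász function.* For a subspace $S\subseteq\mathcal B(\mathcal H)$ with orthogonal complement $S^\perp$ for the Hilbert–Schmidt inner product, $$\tilde\theta(S)=\sup_{k\ge1}\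 \sup\{\|\mathbf 1+T\| : T\in S^\perp\otimes\mathcal B(\mathbb C^k),\ \mathbf 1+T\ge0\}.$$ *Entanglement-assisted zero-error capacity.* A zero-error entanglement-assisted code of block length $l$ with $M$ messages for $\mathcal N\in\mathcal C(\mathcal H,\mathcal K)$ consists of a finite-dimensional Hilbert space $\mathcal F$ with a copy $\mathcal F'$, a state $\sigma$ on $\mathcal F'\otimes\mathcal F$, channels $\mathcal P_1,\dots,\mathcal P_M\in\mathcal C(\mathcal F,\mathcal H^{\otimes l})$ and a POVM $D_1,\dots,D_M$ on $\mathcal F'\otimes\mathcal K^{\otimes l}$ such that $\mathrm{tr}\big((\mathrm{id}_{\mathcal F'}\otimes\mathcal N^{\otimes l}\circ\mathcal P_i)(\sigma)\,D_i\big)=1$ for all $i$. If $M_{\mathrm{EA}}(l,\mathcal N)$ is the largest $M$ for which such a code exists, then $C_{0\mathrm{EA}}(\mathcal N)=\lim_{l\to\infty}\frac1l\log_2 M_{\mathrm{EA}}(l,\mathcal N)$. **Theorem.** 1. $\tilde\theta(S(\mathcal N))$ is finite for every $\mathcal N\in\mathcal C(\mathcal H,\mathcal K)$. 2. $\mathrm{ri}\,\mathcal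 C(\mathcal H,\mathcal K)$ is dense in $\mathcal C(\mathcal H,\mathcal K)$. 3. For every $\mathcal N\in\mathrm{ri}\,\mathcal C(\mathcal H,\mathcal K)$ one has $S(\mathcal N)=\mathcal B(\mathcal H)$ and $\tilde\theta(S(\mathcal N))=1$. 4. The function $\mathcal C(\mathcal H,\mathcal K)\to\mathbb R_+$, $\mathcal N\mapsto\tilde\theta(S(\mathcal N))$, is discontinuous at every $\mathcal N\in\mathcal C(\mathcal H,\mathcal K)$ with $C_{0\mathrm{EA}}(\mathcal N)>0$. In particular all of this holds for $\mathcal K=\mathcal H$. -/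

import Mathlib

open Matrix Filter Topology
open scoped ComplexOrder

/-! Finite-dimensional Hilbert spaces are `ℂ^n` for a finite index type `n`, operators are complex
matrices, and tensor products of spaces are products of index types. -/

/-- Linear maps `B(ℂ^n) → B(ℂ^m)`. -/
abbrev SuperOp (n m : Type*) : Type _ := Matrix n n ℂ →ₗ[ℂ] Matrix m m ℂ

section Channels

variable {n m : Type*}

/-- The map `id_k ⊗ Φ` from `B(ℂ^k ⊗ ℂ^n)` to `B(ℂ^k ⊗ ℂ^m)`: `Φ` is applied to every block. -/
def idTensor (k : Type*) (Φ : SuperOp n m) : SuperOp (k × n) (k × m) where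
  toFun X := Matrix.of fun x y => Φ (Matrix.of fun i j => X (x.1, i) (y.1, j)) x.2 y.2
  map_add' X Y := by
    ext x y
    have h : (Matrix.of fun i j => (X + Y) (x.1, i) (y.1, j) : Matrix n n ℂ)
        = (Matrix.of fun i j => X (x.1, i) (y.1, j))
          + (Matrix.of fun i j => Y (x.1, i) (y.1, j)) := rfl
    simp only [Matrix.of_apply, Matrix.add_apply]
    rw [← Matrix.add_apply, ← map_add]
    rfl
  map_smul' c X := by
    ext x y
    simp only [Matrix.of_apply, Matrix.smul_apply, RingHom.id_apply]
    rw [← Matrix.smul_apply, ← map_smul]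
    rfl

/-- The tensor power `Φ^{⊗l}`, as a map from operators on `(ℂ^n)^{⊗l}` to operators on
`(ℂ^m)^{⊗l}`: the linear extension of
`|i₁⟩⟨j₁| ⊗ ⋯ ⊗ |i_l⟩⟨j_l| ↦ Φ(|i₁⟩⟨j₁|) ⊗ ⋯ ⊗ Φ(|i_l⟩⟨j_l|)`. -/
def tensorPower [Fintype n] [DecidableEq n] (Φ : SuperOp n m) (l : ℕ) :
    SuperOp (Fin l → n) (Fin l → m) where
  toFun X := Matrix.of fun a b =>
    ∑ i : Fin l → n, ∑ j : Fin l → n,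
      X i j * ∏ t, Φ (Matrix.single (i t) (j t) 1) (a t) (b t)
  map_add' X Y := by
    ext a b
    simp [add_mul, Finset.sum_add_distrib]
  map_smul' c X := by
    ext a b
    simp [mul_assoc, Finset.mul_sum]

/-- Complete positivity: `id_k ⊗ Φ` maps positive semidefinite matrices to positive semidefinite
matrices for every `k`. -/
def IsCompletelyPositive (Φ : SuperOp n m) : Prop :=
  ∀ (k : ℕ) (X : Matrix (Fin k × n) (Fin k × n) ℂ), X.PosSemidef →
    (idTensor (Fin k) Φ X).PosSemidef

/-- The set of quantum channels from `ℂ^n` to `ℂ^m`: completely positive trace preserving maps. -/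
def channels (n m : Type*) [Fintype n] [Fintype m] : Set (SuperOp n m) :=
  {Φ | IsCompletelyPositive Φ ∧ ∀ X, (Φ X).trace = X.trace}

end Channels

section TraceNorm

variable {n m : Type*} [Fintype n] [DecidableEq n] [Fintype m] [DecidableEq m]

/-- The trace norm `‖a‖₁ = tr √(a* a)`, the sum of the singular values of `a`. -/
noncomputable def traceNorm (a : Matrix n n ℂ) : ℝ :=
  ∑ i, √((Matrix.isHermitian_conjTranspose_mul_self a).eigenvalues i)

/-- The diamond norm, `sup_k max {‖(id_k ⊗ Φ)(a)‖₁ : a ∈ B(ℂ^k ⊗ ℂ^n), ‖a‖₁ = 1}`. -/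
noncomputable def diamondNorm (Φ : SuperOp n m) : ℝ :=
  sSup {r | ∃ (k : ℕ) (a : Matrix (Fin k × n) (Fin k × n) ℂ),
    traceNorm a = 1 ∧ r = traceNorm (idTensor (Fin k) Φ a)}


open scoped Matrix.Norms.L2Operator in
theorem norm_trace_mul_le (U a : Matrix n n ℂ) : ‖(U * a).trace‖ ≤ ‖U‖ * traceNorm a := by
  set hA := Matrix.isHermitian_conjTranspose_mul_self a with hAdef
  set V : Matrix n n ℂ := (hA.eigenvectorUnitary : Matrix n n ℂ) with hV
  have hVV : V * star V = 1 := Unitary.coe_mul_star_self hA.eigenvectorUnitary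
  have hVV' : star V * V = 1 := Unitary.coe_star_mul_self hA.eigenvectorUnitary
  obtain ⟨L, hL⟩ : ∃ L : Matrix n n ℂ, L = diagonal (RCLike.ofReal ∘ hA.eigenvalues) := ⟨_, rfl⟩
  have hspec : aᴴ * a = V * L * star V := by
    have := hA.spectral_theorem
    rwa [Unitary.conjStarAlgAut_apply, ← hL] at this
  have hdiag : (a * V)ᴴ * (a * V) = L := by
    rw [conjTranspose_mul, Matrix.mul_assoc, ← Matrix.mul_assoc aᴴ, hspec]
    rw [← star_eq_conjTranspose]
    calc star V * (V * L * star V * V) = (star V * V) * L * (star V * V) := by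
          simp only [Matrix.mul_assoc]
      _ = _ := by rw [hVV']; simp
  have htr : (U * a).trace = (star V * U * (a * V)).trace := by
    rw [Matrix.mul_assoc, Matrix.trace_mul_comm (star V)]
    simp only [Matrix.mul_assoc]
    rw [hVV, Matrix.mul_one]
  have hcol : ∀ i, ‖(WithLp.toLp 2 ((a * V) *ᵥ Pi.single i 1) : EuclideanSpace ℂ n)‖
      = √(hA.eigenvalues i) := by
    intro i
    rw [← Real.sqrt_sq (norm_nonneg _)]
    congr 1
    have h1 : ((‖(WithLp.toLp 2 ((a * V) *ᵥ Pi.single i 1) : EuclideanSpace ℂ n)‖ ^ 2 : ℝ) : ℂ)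
        = ((a * V)ᴴ * (a * V)) i i := by
      rw [EuclideanSpace.norm_sq_eq, Matrix.mul_apply]
      push_cast
      refine Finset.sum_congr rfl fun j _ => ?_
      simp only [Matrix.mulVec_single_one, Matrix.col_apply, conjTranspose_apply]
      rw [← Complex.conj_mul']
      rfl
    rw [hdiag, hL, diagonal_apply_eq] at h1
    exact Complex.ofReal_injective h1
  have hUn : ‖star V * U‖ = ‖U‖ := by
    have := CStarRing.norm_coe_unitary_mul (star hA.eigenvectorUnitary) U
    simpa using this
  rw [htr, Matrix.trace]
  refine (norm_sum_le _ _).trans ?_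
  rw [traceNorm, Finset.mul_sum]
  refine Finset.sum_le_sum fun i _ => ?_
  have h2 := Matrix.l2_opNorm_mulVec (star V * U)
    (WithLp.toLp 2 ((a * V) *ᵥ Pi.single i 1) : EuclideanSpace ℂ n)
  rw [hcol, hUn] at h2
  refine le_trans ?_ h2
  have h3 := PiLp.norm_apply_le (p := 2) ((EuclideanSpace.equiv n ℂ).symm ((star V * U) *ᵥ
    (WithLp.toLp 2 ((a * V) *ᵥ Pi.single i 1) : EuclideanSpace ℂ n).ofLp)) i
  refine le_trans (le_of_eq ?_) h3
  have h4 : (star V * U) *ᵥ ((a * V) *ᵥ Pi.single i 1) = (star V * U * (a * V)).col i := by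
    rw [Matrix.mulVec_mulVec, Matrix.mulVec_single_one]
  change _ = ‖((star V * U) *ᵥ ((a * V) *ᵥ Pi.single i 1)) i‖
  rw [h4]
  rfl

open scoped Matrix.Norms.L2Operator in
theorem exists_trace_mul_eq (a : Matrix n n ℂ) :
    ∃ U : Matrix n n ℂ, ‖U‖ ≤ 1 ∧ (U * a).trace = traceNorm a := by
  set hA := Matrix.isHermitian_conjTranspose_mul_self a with hAdef
  have hpos : ∀ i, 0 ≤ hA.eigenvalues i :=
    fun i => (Matrix.posSemidef_conjTranspose_mul_self a).eigenvalues_nonneg i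
  set V : Matrix n n ℂ := (hA.eigenvectorUnitary : Matrix n n ℂ) with hV
  have hVV' : star V * V = 1 := Unitary.coe_star_mul_self hA.eigenvectorUnitary
  set D : Matrix n n ℂ := diagonal fun i => (((√(hA.eigenvalues i))⁻¹ : ℝ) : ℂ) with hD
  obtain ⟨L, hL⟩ : ∃ L : Matrix n n ℂ, L = diagonal (RCLike.ofReal ∘ hA.eigenvalues) := ⟨_, rfl⟩
  have hspec : aᴴ * a = V * L * star V := by
    have := hA.spectral_theorem
    rwa [Unitary.conjStarAlgAut_apply, ← hL] at this
  have hDs : Dᴴ = D := by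
    rw [hD, diagonal_conjTranspose]
    congr 1
    ext i
    simp
  have hVs : star V = Vᴴ := rfl
  refine ⟨V * D * star V * aᴴ, ?_, ?_⟩
  · have h1 : (V * D * star V * aᴴ) * (V * D * star V * aᴴ)ᴴ
        = V * (D * L * D) * star V := by
      simp only [conjTranspose_mul, conjTranspose_conjTranspose, hDs, hVs]
      calc V * D * Vᴴ * aᴴ * (a * (V * (D * Vᴴ)))
          = V * D * Vᴴ * (aᴴ * a) * V * D * Vᴴ := by simp only [Matrix.mul_assoc]
        _ = V * D * (star V * V) * L * (star V * V)
              * D * Vᴴ := by rw [hspec, hVs]; simp only [Matrix.mul_assoc]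
        _ = _ := by rw [hVV']; simp [Matrix.mul_assoc]
    have h2 : ‖V * D * star V * aᴴ‖ * ‖V * D * star V * aᴴ‖ ≤ 1 := by
      rw [← l2_opNorm_conjTranspose (V * D * star V * aᴴ), ← l2_opNorm_conjTranspose_mul_self,
        conjTranspose_conjTranspose, h1]
      have e1 : ∀ X : Matrix n n ℂ, ‖V * X * star V‖ = ‖X‖ := by
        intro X
        have q1 := CStarRing.norm_coe_unitary_mul hA.eigenvectorUnitary (X * star V)
        have q2 := CStarRing.norm_mul_coe_unitary X (star hA.eigenvectorUnitary)
        rw [Matrix.mul_assoc]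
        rw [q1]
        exact q2
      rw [e1, hD, hL, diagonal_mul_diagonal, diagonal_mul_diagonal, l2_opNorm_diagonal]
      refine (pi_norm_le_iff_of_nonneg zero_le_one).2 fun i => ?_
      have : ((((√(hA.eigenvalues i))⁻¹ : ℝ) : ℂ) * (RCLike.ofReal ∘ hA.eigenvalues) i
          * (((√(hA.eigenvalues i))⁻¹ : ℝ) : ℂ))
          = (((√(hA.eigenvalues i))⁻¹ * hA.eigenvalues i * (√(hA.eigenvalues i))⁻¹ : ℝ) : ℂ) := by
        push_cast
        rfl
      rw [this, Complex.norm_real]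
      rcases (hpos i).eq_or_lt with h0 | h0
      · rw [← h0]; simp
      · have hs : 0 < √(hA.eigenvalues i) := Real.sqrt_pos.2 h0
        have : (√(hA.eigenvalues i))⁻¹ * hA.eigenvalues i * (√(hA.eigenvalues i))⁻¹ = 1 := by
          nth_rewrite 2 [← Real.mul_self_sqrt (hpos i)]
          field_simp
        rw [this]; simp
    nlinarith [norm_nonneg (V * D * star V * aᴴ)]
  · have h1 : V * D * star V * aᴴ * a
        = V * (D * L) * star V := by
      calc V * D * star V * aᴴ * a = V * D * star V * (aᴴ * a) := by
            simp only [Matrix.mul_assoc]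
        _ = V * D * (star V * V) * L * star V := by
            rw [hspec]; simp only [Matrix.mul_assoc]
        _ = _ := by rw [hVV']; simp [Matrix.mul_assoc]
    rw [h1, Matrix.trace_mul_comm, ← Matrix.mul_assoc, hVV', Matrix.one_mul, hD, hL,
      diagonal_mul_diagonal, trace_diagonal, traceNorm]
    push_cast
    refine Finset.sum_congr rfl fun i _ => ?_
    rcases (hpos i).eq_or_lt with h0 | h0
    · simp [← h0]
    · have hs : √(hA.eigenvalues i) ≠ 0 := (Real.sqrt_pos.2 h0).ne'
      have : (√(hA.eigenvalues i))⁻¹ * hA.eigenvalues i = √(hA.eigenvalues i) := by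
        nth_rewrite 2 [← Real.mul_self_sqrt (hpos i)]
        field_simp
      have h2 := congrArg (fun x : ℝ => (x : ℂ)) this
      simp only [Complex.ofReal_mul, Complex.ofReal_inv] at h2
      exact h2

theorem traceNorm_nonneg (a : Matrix n n ℂ) : 0 ≤ traceNorm a :=
  Finset.sum_nonneg fun _ _ => Real.sqrt_nonneg _

open scoped Matrix.Norms.L2Operator in
theorem traceNorm_le_of_forall {a : Matrix n n ℂ} {c : ℝ}
    (h : ∀ U : Matrix n n ℂ, ‖U‖ ≤ 1 → ‖(U * a).trace‖ ≤ c) : traceNorm a ≤ c := by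
  obtain ⟨U, hU, hUa⟩ := exists_trace_mul_eq a
  have := h U hU
  rwa [hUa, Complex.norm_real, Real.norm_of_nonneg (traceNorm_nonneg a)] at this

theorem traceNorm_add_le (a b : Matrix n n ℂ) :
    traceNorm (a + b) ≤ traceNorm a + traceNorm b := by
  refine traceNorm_le_of_forall fun U hU => ?_
  rw [Matrix.mul_add, Matrix.trace_add]
  refine (norm_add_le _ _).trans (add_le_add ?_ ?_)
  · refine (norm_trace_mul_le U a).trans ?_
    nlinarith [traceNorm_nonneg a]
  · refine (norm_trace_mul_le U b).trans ?_
    nlinarith [traceNorm_nonneg b]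

theorem traceNorm_smul_le (c : ℂ) (a : Matrix n n ℂ) :
    traceNorm (c • a) ≤ ‖c‖ * traceNorm a := by
  refine traceNorm_le_of_forall fun U hU => ?_
  rw [Matrix.mul_smul, Matrix.trace_smul, norm_smul]
  refine mul_le_mul_of_nonneg_left ((norm_trace_mul_le U a).trans ?_) (norm_nonneg _)
  nlinarith [traceNorm_nonneg a]

theorem traceNorm_smul (c : ℂ) (a : Matrix n n ℂ) :
    traceNorm (c • a) = ‖c‖ * traceNorm a := by
  refine le_antisymm (traceNorm_smul_le c a) ?_
  by_cases hc : c = 0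
  · subst hc; simpa using traceNorm_nonneg _
  have h := traceNorm_smul_le c⁻¹ (c • a)
  rw [smul_smul, inv_mul_cancel₀ hc, one_smul, norm_inv] at h
  have h0 : 0 < ‖c‖ := norm_pos_iff.2 hc
  rwa [inv_mul_eq_div, le_div_iff₀ h0, mul_comm] at h

theorem eq_zero_of_traceNorm {a : Matrix n n ℂ} (h : traceNorm a = 0) : a = 0 := by
  have hpos := fun i => (Matrix.posSemidef_conjTranspose_mul_self a).eigenvalues_nonneg i
  have h1 := (Finset.sum_eq_zero_iff_of_nonneg fun i _ => Real.sqrt_nonneg _).1 h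
  rw [← Matrix.trace_conjTranspose_mul_self_eq_zero_iff,
    (Matrix.isHermitian_conjTranspose_mul_self a).trace_eq_sum_eigenvalues]
  refine Finset.sum_eq_zero fun i hi => ?_
  have h2 := (Real.sqrt_eq_zero (hpos i)).1 (h1 i hi)
  rw [h2]; simp

/-- A bound on `‖(id_k ⊗ Φ)(a)‖₁` that does not depend on `k`. -/
noncomputable def entrySum (Φ : SuperOp n m) : ℝ :=
  ∑ p : n, ∑ q : n, ∑ i : m, ∑ j : m, ‖Φ (Matrix.single p q 1) i j‖

/-- `1 ⊗ |i⟩⟨p|`. -/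
def blockUnit (k : Type*) [DecidableEq k] (i : m) (p : n) : Matrix (k × m) (k × n) ℂ :=
  Matrix.kroneckerMap (· * ·) (1 : Matrix k k ℂ) (Matrix.single i p 1)

open scoped Matrix.Norms.L2Operator in
theorem norm_blockUnit_le {k : Type*} [Fintype k] [DecidableEq k] (i : m) (p : n) :
    ‖blockUnit k i p‖ ≤ 1 := by
  have h1 : (blockUnit k i p)ᴴ * blockUnit k i p
      = diagonal (fun x : k × n => if x.2 = p then (1 : ℂ) else 0) := by
    unfold blockUnit
    rw [conjTranspose_kronecker, ← mul_kronecker_mul]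
    ext x y
    simp only [conjTranspose_one, Matrix.mul_one, conjTranspose_single, star_one,
      single_mul_single_same, kroneckerMap_apply, Matrix.one_apply, Matrix.single_apply,
      diagonal_apply, Prod.ext_iff]
    grind
  have h2 : ‖blockUnit k i p‖ * ‖blockUnit k i p‖ ≤ 1 := by
    rw [← l2_opNorm_conjTranspose_mul_self, h1, l2_opNorm_diagonal]
    refine (pi_norm_le_iff_of_nonneg zero_le_one).2 fun x => ?_
    split_ifs <;> simp
  nlinarith [norm_nonneg (blockUnit k i p)]

theorem idTensor_eq_sum {k : Type*} [Fintype k] [DecidableEq k] (Φ : SuperOp n m)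
    (a : Matrix (k × n) (k × n) ℂ) :
    idTensor k Φ a = ∑ p : n, ∑ q : n, ∑ i : m, ∑ j : m,
      Φ (Matrix.single p q 1) i j • (blockUnit k i p * a * (blockUnit k j q)ᴴ) := by
  have hb : ∀ (i : m) (p : n) (j : m) (q : n) (x y : k × m),
      (blockUnit k i p * a * (blockUnit k j q)ᴴ) x y
        = if i = x.2 ∧ j = y.2 then a (x.1, p) (y.1, q) else 0 := by
    intro i p j q x y
    simp only [Matrix.mul_apply, blockUnit, kroneckerMap_apply, conjTranspose_apply,
      Matrix.one_apply, Matrix.single_apply, Fintype.sum_prod_type]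
    by_cases hi : i = x.2 <;> by_cases hj : j = y.2 <;>
      simp [hi, hj, Finset.sum_ite_eq, apply_ite (starRingEnd ℂ)]
  ext x y
  simp only [Matrix.sum_apply, Matrix.smul_apply, hb, smul_eq_mul]
  have h1 : (Matrix.of fun i j => a (x.1, i) (y.1, j) : Matrix n n ℂ)
      = ∑ p : n, ∑ q : n, a (x.1, p) (y.1, q) • Matrix.single p q (1 : ℂ) := by
    conv_lhs => rw [Matrix.matrix_eq_sum_single
      (Matrix.of fun i j => a (x.1, i) (y.1, j) : Matrix n n ℂ)]
    simp [Matrix.smul_single]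
  change Φ (Matrix.of fun i j => a (x.1, i) (y.1, j)) x.2 y.2 = _
  rw [h1]
  simp only [map_sum, map_smul, Matrix.sum_apply, Matrix.smul_apply, smul_eq_mul]
  refine Finset.sum_congr rfl fun p _ => Finset.sum_congr rfl fun q _ => ?_
  simp only [ite_and, mul_ite, mul_zero, Finset.sum_ite_eq', Finset.sum_ite_irrel,
    Finset.sum_const_zero, Finset.mem_univ, if_true]
  ring

theorem traceNorm_sum_le {ι : Type*} (s : Finset ι) (f : ι → Matrix n n ℂ) :
    traceNorm (∑ i ∈ s, f i) ≤ ∑ i ∈ s, traceNorm (f i) := by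
  refine Finset.le_sum_of_subadditive traceNorm ?_ traceNorm_add_le s f
  have h := traceNorm_smul (0 : ℂ) (0 : Matrix n n ℂ)
  rw [zero_smul, norm_zero, zero_mul] at h
  exact h.le

open scoped Matrix.Norms.L2Operator in
theorem traceNorm_idTensor_le {k : Type*} [Fintype k] [DecidableEq k] (Φ : SuperOp n m)
    (a : Matrix (k × n) (k × n) ℂ) :
    traceNorm (idTensor k Φ a) ≤ entrySum Φ * traceNorm a := by
  have hb : ∀ (i : m) (p : n) (j : m) (q : n),
      traceNorm (blockUnit k i p * a * (blockUnit k j q)ᴴ) ≤ traceNorm a := by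
    intro i p j q
    refine traceNorm_le_of_forall fun U hU => ?_
    have h1 : (U * (blockUnit k i p * a * (blockUnit k j q)ᴴ)).trace
        = ((blockUnit k j q)ᴴ * U * blockUnit k i p * a).trace := by
      rw [← Matrix.mul_assoc, Matrix.trace_mul_comm]
      simp only [Matrix.mul_assoc]
    rw [h1]
    refine (norm_trace_mul_le _ _).trans ?_
    have h2 : ‖(blockUnit k j q)ᴴ * U * blockUnit k i p‖ ≤ 1 := by
      refine (l2_opNorm_mul _ _).trans ?_
      refine mul_le_one₀ ((l2_opNorm_mul _ _).trans ?_) (norm_nonneg _) (norm_blockUnit_le i p)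
      refine mul_le_one₀ ?_ (norm_nonneg _) hU
      rw [l2_opNorm_conjTranspose]
      exact norm_blockUnit_le j q
    nlinarith [traceNorm_nonneg a]
  rw [idTensor_eq_sum, entrySum]
  simp only [Finset.sum_mul]
  refine (traceNorm_sum_le _ _).trans (Finset.sum_le_sum fun p _ => ?_)
  refine (traceNorm_sum_le _ _).trans (Finset.sum_le_sum fun q _ => ?_)
  refine (traceNorm_sum_le _ _).trans (Finset.sum_le_sum fun i _ => ?_)
  refine (traceNorm_sum_le _ _).trans (Finset.sum_le_sum fun j _ => ?_)
  rw [traceNorm_smul]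
  exact mul_le_mul_of_nonneg_left (hb i p j q) (norm_nonneg _)

theorem diamondNorm_bddAbove (Φ : SuperOp n m) :
    BddAbove {r | ∃ (k : ℕ) (a : Matrix (Fin k × n) (Fin k × n) ℂ),
      traceNorm a = 1 ∧ r = traceNorm (idTensor (Fin k) Φ a)} := by
  refine ⟨entrySum Φ, ?_⟩
  rintro r ⟨k, a, ha, rfl⟩
  simpa [ha] using traceNorm_idTensor_le Φ a

theorem diamondNorm_nonneg (Φ : SuperOp n m) : 0 ≤ diamondNorm Φ := by
  refine Real.sSup_nonneg ?_
  rintro r ⟨k, a, -, rfl⟩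
  exact traceNorm_nonneg _

theorem traceNorm_idTensor_le_diamondNorm (Φ : SuperOp n m) (k : ℕ)
    (a : Matrix (Fin k × n) (Fin k × n) ℂ) :
    traceNorm (idTensor (Fin k) Φ a) ≤ diamondNorm Φ * traceNorm a := by
  rcases (traceNorm_nonneg a).eq_or_lt with h0 | h0
  · have := traceNorm_idTensor_le Φ a
    rwa [← h0, mul_zero] at this ⊢
  · have h1 : traceNorm (((traceNorm a)⁻¹ : ℂ) • a) = 1 := by
      rw [traceNorm_smul, norm_inv, Complex.norm_real, Real.norm_of_nonneg h0.le,
        inv_mul_cancel₀ h0.ne']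
    have h2 : traceNorm (idTensor (Fin k) Φ (((traceNorm a)⁻¹ : ℂ) • a)) ≤ diamondNorm Φ :=
      le_csSup (diamondNorm_bddAbove Φ) ⟨k, _, h1, rfl⟩
    rw [map_smul, traceNorm_smul, norm_inv, Complex.norm_real, Real.norm_of_nonneg h0.le,
      inv_mul_eq_div, div_le_iff₀ h0] at h2
    exact h2

theorem diamondNorm_le {Φ : SuperOp n m} {c : ℝ} (hc : 0 ≤ c)
    (h : ∀ (k : ℕ) (a : Matrix (Fin k × n) (Fin k × n) ℂ),
      traceNorm (idTensor (Fin k) Φ a) ≤ c * traceNorm a) : diamondNorm Φ ≤ c := by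
  refine Real.sSup_le ?_ hc
  rintro r ⟨k, a, ha, rfl⟩
  simpa [ha] using h k a

theorem diamondNorm_add_le (Φ Ψ : SuperOp n m) :
    diamondNorm (Φ + Ψ) ≤ diamondNorm Φ + diamondNorm Ψ := by
  refine diamondNorm_le (add_nonneg (diamondNorm_nonneg _) (diamondNorm_nonneg _)) fun k a => ?_
  have h : idTensor (Fin k) (Φ + Ψ) a = idTensor (Fin k) Φ a + idTensor (Fin k) Ψ a := by
    ext x y; rfl
  rw [h, add_mul]
  exact (traceNorm_add_le _ _).trans (add_le_add (traceNorm_idTensor_le_diamondNorm Φ k a)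
    (traceNorm_idTensor_le_diamondNorm Ψ k a))

theorem diamondNorm_smul_le (c : ℂ) (Φ : SuperOp n m) :
    diamondNorm (c • Φ) ≤ ‖c‖ * diamondNorm Φ := by
  refine diamondNorm_le (mul_nonneg (norm_nonneg _) (diamondNorm_nonneg _)) fun k a => ?_
  have h : idTensor (Fin k) (c • Φ) a = c • idTensor (Fin k) Φ a := by
    ext x y; rfl
  rw [h, traceNorm_smul, mul_assoc]
  exact mul_le_mul_of_nonneg_left (traceNorm_idTensor_le_diamondNorm Φ k a) (norm_nonneg _)

theorem eq_zero_of_diamondNorm {Φ : SuperOp n m} (h : diamondNorm Φ = 0) : Φ = 0 := by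
  refine LinearMap.ext fun X => ?_
  have h1 := traceNorm_idTensor_le_diamondNorm Φ 1 (Matrix.of fun x y => X x.2 y.2)
  rw [h, zero_mul] at h1
  have h2 := eq_zero_of_traceNorm (le_antisymm h1 (traceNorm_nonneg _))
  ext i j
  exact congrFun (congrFun h2 (0, i)) (0, j)

theorem diamondNorm_neg_le (Φ : SuperOp n m) : diamondNorm (-Φ) ≤ diamondNorm Φ := by
  have h := diamondNorm_smul_le (-1 : ℂ) Φ
  have e : (-1 : ℂ) • Φ = -Φ := LinearMap.ext fun X => neg_one_smul ℂ (Φ X)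
  rwa [e, norm_neg, norm_one, one_mul] at h

theorem diamondNorm_zero : diamondNorm (0 : SuperOp n m) = 0 := by
  have h := diamondNorm_smul_le (0 : ℂ) (0 : SuperOp n m)
  rw [zero_smul, norm_zero, zero_mul] at h
  exact le_antisymm h (diamondNorm_nonneg _)

/-- The space of linear maps `B(ℂ^n) → B(ℂ^m)` is normed by the diamond norm. -/
noncomputable instance SuperOp.instNormedAddCommGroup : NormedAddCommGroup (SuperOp n m) :=
  AddGroupNorm.toNormedAddCommGroup
    { toFun := diamondNorm
      map_zero' := diamondNorm_zero
      add_le' := diamondNorm_add_le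
      neg' := fun Φ => le_antisymm (diamondNorm_neg_le Φ)
        (by simpa only [neg_neg] using diamondNorm_neg_le (-Φ))
      eq_zero_of_map_eq_zero' := fun _ h => eq_zero_of_diamondNorm h }

noncomputable instance SuperOp.instNormedSpace : NormedSpace ℂ (SuperOp n m) where
  norm_smul_le := diamondNorm_smul_le

end TraceNorm

section Graph

variable {n m : Type*} [Fintype n]

/-- The non-commutative confusability graph `S(N) = span {E_j* E_i}`, for Kraus operators `E_i` of
`N`. The span does not depend on the choice of the Kraus operators, so the generators coming from
all the choices are put together. -/
def confusabilityGraph [Fintype m] (N : SuperOp n m) : Submodule ℂ (Matrix n n ℂ) :=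
  Submodule.span ℂ {X | ∃ (K : ℕ) (E : Fin K → Matrix m n ℂ),
    (∀ Y, N Y = ∑ i, E i * Y * (E i)ᴴ) ∧ ∃ i j, X = (E j)ᴴ * E i}

/-- The orthogonal complement with respect to the Hilbert-Schmidt inner product
`⟨X, T⟩ = tr(X* T)`. -/
def hsOrthogonal (S : Submodule ℂ (Matrix n n ℂ)) : Submodule ℂ (Matrix n n ℂ) where
  carrier := {T | ∀ X ∈ S, (Xᴴ * T).trace = 0}
  add_mem' := by
    intro T T' h h' X hX
    rw [Matrix.mul_add, Matrix.trace_add, h X hX, h' X hX, add_zero]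
  zero_mem' := by
    intro X _
    simp
  smul_mem' := by
    intro c T h X hX
    rw [Matrix.mul_smul, Matrix.trace_smul, h X hX, smul_zero]

/-- `S ⊗ B(ℂ^k)` as a subspace of `B(ℂ^n ⊗ ℂ^k)`. -/
def tensorFull (S : Submodule ℂ (Matrix n n ℂ)) (k : ℕ) :
    Submodule ℂ (Matrix (n × Fin k) (n × Fin k) ℂ) :=
  Submodule.span ℂ {Z | ∃ T ∈ S, ∃ B : Matrix (Fin k) (Fin k) ℂ,
    Z = Matrix.kroneckerMap (· * ·) T B}

/-- The numbers `‖1 + T‖` (operator norm) with `T ∈ S^⊥ ⊗ B(ℂ^k)`, `k ≥ 1`, and `1 + T ≥ 0`. -/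
def lovaszValues [DecidableEq n] (S : Submodule ℂ (Matrix n n ℂ)) : Set ℝ :=
  {r | ∃ k : ℕ, 1 ≤ k ∧ ∃ T ∈ tensorFull (hsOrthogonal S) k,
    (1 + T).PosSemidef ∧ r = ‖Matrix.toEuclideanCLM (n := n × Fin k) (𝕜 := ℂ) (1 + T)‖}

/-- The quantum Lovász function of Duan, Severini and Winter,
`θ̃(S) = sup_k max {‖1 + T‖ : T ∈ S^⊥ ⊗ B(ℂ^k), 1 + T ≥ 0}`. -/
noncomputable def lovaszTheta [DecidableEq n] (S : Submodule ℂ (Matrix n n ℂ)) : ℝ :=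
  sSup (lovaszValues S)

end Graph

section Capacity

variable {n m : Type*} [Fintype n] [DecidableEq n] [Fintype m] [DecidableEq m]

/-- A zero-error entanglement-assisted code for `N` with block length `l` and `M` messages, with
assisting systems `F = F' = ℂ^f`: a state `σ` on `F' ⊗ F`, encoding channels `P_i` from `F` to
`(ℂ^n)^{⊗l}` and a POVM `D` on `F' ⊗ (ℂ^m)^{⊗l}` such that
`tr ((id_{F'} ⊗ N^{⊗l} ∘ P_i)(σ) D_i) = 1` for all messages `i`. -/
structure IsZeroErrorEACode (N : SuperOp n m) (l M f : ℕ)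
    (σ : Matrix (Fin f × Fin f) (Fin f × Fin f) ℂ)
    (P : Fin M → SuperOp (Fin f) (Fin l → n))
    (D : Fin M → Matrix (Fin f × (Fin l → m)) (Fin f × (Fin l → m)) ℂ) : Prop where
  state_posSemidef : σ.PosSemidef
  state_trace : σ.trace = 1
  encoder_mem : ∀ i, P i ∈ channels (Fin f) (Fin l → n)
  povm_posSemidef : ∀ i, (D i).PosSemidef
  povm_sum : ∑ i, D i = 1
  zero_error : ∀ i, (idTensor (Fin f) (tensorPower N l ∘ₗ P i) σ * D i).trace = 1

/-- `M_EA(l, N)`: the largest number of messages of a zero-error entanglement-assisted code of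
block length `l`. -/
noncomputable def maxMessagesEA (l : ℕ) (N : SuperOp n m) : ℕ :=
  sSup {M | ∃ f σ P D, IsZeroErrorEACode N l M f σ P D}

/-- The entanglement-assisted classical zero-error capacity
`C_{0EA}(N) = lim_{l → ∞} (1/l) log₂ M_EA(l, N)`. -/
noncomputable def zeroErrorCapacityEA (N : SuperOp n m) : ℝ :=
  limUnder atTop fun l : ℕ => (1 / (l : ℝ)) * Real.logb 2 (maxMessagesEA l N)

end Capacity

/-! The function jumps because S(N) is the full matrix algebra for generic channels, whereas
positive capacity forces it to be proper.

Trace preservation puts 1 into S(N). Hence every T in S^⊥ ⊗ B(ℂ^k) has zero partial trace over ℂ^n,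
and a positive 1 + T whose partial trace is a fixed multiple of 1 is bounded independently of k
(`bddAbove_lovaszValues`). If S is full, then T = 0 and the value is 1 (`lovaszTheta_top`). If S is
proper, contains 1 and is closed under adjoints, then S^⊥ contains a nonzero traceless Hermitian
matrix, which already for k = 1 yields a value above 1 (`one_lt_lovaszTheta`).

A channel in the relative interior can be moved slightly away from the depolarizing channel without
leaving the set, so it is a mixture giving the depolarizing channel positive weight. The Kraus
operators of the latter are multiples of all matrix units, which makes S(N) full
(`confusabilityGraph_eq_top_of_mem_intrinsicInterior`). Density is a general fact about
finite-dimensional convex sets.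

If S(N) is full, two messages with orthogonal outputs would have encoded states ω_j, ω_i with ω_j (1
⊗ Y) ω_i = 0 for all Y. Contracting over Y gives τ² = 0 for their common reduced state τ on the
receiver's half of the entanglement, which is impossible (`IsZeroErrorEACode.le_one`). So positive
capacity makes the value exceed 1, while arbitrarily close channels have value 1. -/

open scoped Kronecker

/-! ### Kraus decompositions and the confusability graph -/

section Kraus

variable {n m : Type*} [Fintype n]

/-- `E` is a finite family of Kraus operators of `Φ`. -/
def IsKraus {ι : Type*} [Fintype ι] (Φ : SuperOp n m) (E : ι → Matrix m n ℂ) : Prop :=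
  ∀ Y, Φ Y = ∑ i, E i * Y * (E i)ᴴ

theorem mul_mul_conjTranspose_apply {a b : Type*} [Fintype a] (E : Matrix b a ℂ)
    (Y : Matrix a a ℂ) (i j : b) :
    (E * Y * Eᴴ) i j = ∑ p, ∑ q, Y p q * (E i p * star (E j q)) := by
  simp only [Matrix.mul_apply, conjTranspose_apply, Finset.sum_mul]
  rw [Finset.sum_comm]
  exact Finset.sum_congr rfl fun p _ => Finset.sum_congr rfl fun q _ => by ring

theorem superOp_apply_eq_sum [DecidableEq n] (Φ : SuperOp n m) (Y : Matrix n n ℂ) :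
    Φ Y = ∑ p, ∑ q, Y p q • Φ (Matrix.single p q 1) := by
  conv_lhs => rw [Matrix.matrix_eq_sum_single Y]
  simp only [map_sum, ← map_smul, Matrix.smul_single, smul_eq_mul, mul_one]

theorem isKraus_of_single [DecidableEq n] {ι : Type*} [Fintype ι] {Φ : SuperOp n m}
    {E : ι → Matrix m n ℂ}
    (h : ∀ p q i j, Φ (Matrix.single p q 1) i j = ∑ r, E r i p * star (E r j q)) :
    IsKraus Φ E := by
  intro Y
  ext i j
  rw [superOp_apply_eq_sum]
  simp only [Matrix.sum_apply, Matrix.smul_apply, smul_eq_mul, h, mul_mul_conjTranspose_apply,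
    Finset.mul_sum]
  rw [Finset.sum_comm_cycle]

theorem IsKraus.apply_single [DecidableEq n] {ι : Type*} [Fintype ι] {Φ : SuperOp n m}
    {E : ι → Matrix m n ℂ} (h : IsKraus Φ E) (p q : n) (i j : m) :
    Φ (Matrix.single p q 1) i j = ∑ r, E r i p * star (E r j q) := by
  rw [h, Matrix.sum_apply]
  refine Finset.sum_congr rfl fun r _ => ?_
  rw [mul_mul_conjTranspose_apply]
  rw [Finset.sum_eq_single p, Finset.sum_eq_single q]
  · simp
  · intro b _ hb; simp [hb.symm]
  · simp
  · intro b _ hb; simp [hb.symm]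
  · simp

theorem IsKraus.idTensor {ι k : Type*} [Fintype ι] [Fintype k] [DecidableEq k]
    {Φ : SuperOp n m} {E : ι → Matrix m n ℂ} (h : IsKraus Φ E) (X : Matrix (k × n) (k × n) ℂ) :
    idTensor k Φ X = ∑ r, ((1 : Matrix k k ℂ) ⊗ₖ E r) * X * ((1 : Matrix k k ℂ) ⊗ₖ E r)ᴴ := by
  ext x y
  change Φ (Matrix.of fun i j => X (x.1, i) (y.1, j)) x.2 y.2 = _
  rw [h, Matrix.sum_apply, Matrix.sum_apply]
  refine Finset.sum_congr rfl fun r _ => ?_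
  rw [mul_mul_conjTranspose_apply, mul_mul_conjTranspose_apply]
  simp [Fintype.sum_prod_type, Matrix.one_apply, apply_ite (starRingEnd ℂ), Finset.sum_ite_eq,
    Finset.sum_ite_irrel]

/-- The Kraus family may vary with the tensor factor. This freedom is needed later, because a
spanning set of S(Φ) is collected from different Kraus decompositions. -/
theorem IsKraus.tensorPower [DecidableEq n] {Φ : SuperOp n m} {l : ℕ} {K : Fin l → ℕ}
    {E : ∀ t, Fin (K t) → Matrix m n ℂ} (h : ∀ t, IsKraus Φ (E t)) :
    IsKraus (tensorPower Φ l) fun r : ∀ t, Fin (K t) =>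
      (Matrix.of fun a i => ∏ t, E t (r t) (a t) (i t) : Matrix (Fin l → m) (Fin l → n) ℂ) := by
  intro Y
  ext a b
  change ∑ i : Fin l → n, ∑ j : Fin l → n,
      Y i j * ∏ t, Φ (Matrix.single (i t) (j t) 1) (a t) (b t) = _
  simp only [Matrix.sum_apply, mul_mul_conjTranspose_apply, of_apply]
  symm
  rw [Finset.sum_comm]
  refine Finset.sum_congr rfl fun i _ => ?_
  rw [Finset.sum_comm]
  refine Finset.sum_congr rfl fun j _ => ?_
  symm
  rw [← Finset.mul_sum]
  congr 1
  rw [Finset.prod_congr rfl fun t _ => (h t).apply_single (i t) (j t) (a t) (b t),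
    Fintype.prod_sum]
  simp only [Finset.prod_mul_distrib, star_prod]

variable [Fintype m]

/-- Choi's theorem: completely positive maps have Kraus decompositions. -/
theorem IsCompletelyPositive.exists_isKraus [DecidableEq n] {Φ : SuperOp n m}
    (h : IsCompletelyPositive Φ) : ∃ (K : ℕ) (E : Fin K → Matrix m n ℂ), IsKraus Φ E := by
  set e := Fintype.equivFin n
  -- `w` is the unnormalized maximally entangled vector. A decomposition of the Choi matrix into
  -- rank-one terms gives the Kraus operators by reshaping the vectors.
  set w : Fin (Fintype.card n) × n → ℂ := fun x => if e x.2 = x.1 then 1 else 0 with hw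
  obtain ⟨K, v, hv⟩ := Matrix.posSemidef_iff_eq_sum_vecMulVec.1
    (h _ _ (Matrix.posSemidef_vecMulVec_self_star w))
  refine ⟨K, fun r => Matrix.of fun i p => v r (e p, i), isKraus_of_single fun p q i j => ?_⟩
  have h1 := congrFun (congrFun hv (e p, i)) (e q, j)
  have h2 : (Matrix.of fun i j => vecMulVec w (star w) (e p, i) (e q, j) : Matrix n n ℂ)
      = Matrix.single p q 1 := by
    ext a b
    simp only [hw, of_apply, vecMulVec_apply, Pi.star_apply, Matrix.single_apply,
      EmbeddingLike.apply_eq_iff_eq, eq_comm (a := a), eq_comm (a := b)]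
    by_cases ha : p = a <;> by_cases hb : q = b <;> simp [ha, hb]
  change Φ (Matrix.of fun i j => vecMulVec w (star w) (e p, i) (e q, j) : Matrix n n ℂ) i j = _
    at h1
  rw [h2, Matrix.sum_apply] at h1
  exact h1

theorem IsKraus.isCompletelyPositive {ι : Type*} [Fintype ι] {Φ : SuperOp n m}
    {E : ι → Matrix m n ℂ} (h : IsKraus Φ E) : IsCompletelyPositive Φ := by
  intro k X hX
  rw [h.idTensor]
  exact posSemidef_sum _ fun r _ => hX.mul_mul_conjTranspose_same _

theorem IsKraus.mem_confusabilityGraph {ι : Type*} [Fintype ι] {Φ : SuperOp n m}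
    {E : ι → Matrix m n ℂ} (h : IsKraus Φ E) (i j : ι) :
    (E j)ᴴ * E i ∈ confusabilityGraph Φ := by
  let e := Fintype.equivFin ι
  refine Submodule.subset_span ⟨Fintype.card ι, fun r => E (e.symm r), fun Y => ?_, e i, e j, ?_⟩
  · rw [h Y]
    exact (e.symm.sum_comp fun r => E r * Y * (E r)ᴴ).symm
  · simp

/-- Taking adjoints swaps the two Kraus indices of a generator. -/
theorem conjTranspose_mem_confusabilityGraph {Φ : SuperOp n m} {X : Matrix n n ℂ}
    (hX : X ∈ confusabilityGraph Φ) : Xᴴ ∈ confusabilityGraph Φ := by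
  induction hX using Submodule.span_induction with
  | mem X hX =>
    obtain ⟨K, E, hE, i, j, rfl⟩ := hX
    exact Submodule.subset_span ⟨K, E, hE, j, i, by simp⟩
  | zero => simp
  | add X Y _ _ hX hY => rw [conjTranspose_add]; exact add_mem hX hY
  | smul c X _ hX => rw [conjTranspose_smul]; exact Submodule.smul_mem _ _ hX

theorem IsKraus.sum_conjTranspose_mul [DecidableEq n] {ι : Type*} [Fintype ι] {Φ : SuperOp n m}
    {E : ι → Matrix m n ℂ} (h : IsKraus Φ E) (htr : ∀ X, (Φ X).trace = X.trace) :
    ∑ r, (E r)ᴴ * E r = 1 := by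
  ext q p
  have h1 := htr (Matrix.single p q 1)
  simp only [Matrix.trace, Matrix.diag_apply, h.apply_single] at h1
  rw [Finset.sum_comm] at h1
  simp only [Matrix.sum_apply, Matrix.mul_apply, conjTranspose_apply]
  have h2 : ∑ i, Matrix.single p q (1 : ℂ) i i = (1 : Matrix n n ℂ) q p := by
    simp [Matrix.single_apply, Matrix.one_apply, ite_and]
  rw [← h2, ← h1]
  exact Finset.sum_congr rfl fun r _ => Finset.sum_congr rfl fun i _ => mul_comm _ _

theorem one_mem_confusabilityGraph [DecidableEq n] {Φ : SuperOp n m} (h : Φ ∈ channels n m) :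
    1 ∈ confusabilityGraph Φ := by
  obtain ⟨K, E, hE⟩ := h.1.exists_isKraus
  rw [← hE.sum_conjTranspose_mul h.2]
  exact sum_mem fun r _ => hE.mem_confusabilityGraph r r

/-- On a product of matrix units the trace of the image factors over the tensor positions, and each
factor is a Kronecker delta. -/
theorem trace_tensorPower [DecidableEq n] {Φ : SuperOp n m} (h : ∀ X, (Φ X).trace = X.trace)
    (l : ℕ) (X : Matrix (Fin l → n) (Fin l → n) ℂ) : (tensorPower Φ l X).trace = X.trace := by
  have h1 : ∀ p q : n, ∑ a, Φ (Matrix.single p q 1) a a = if p = q then 1 else 0 := by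
    intro p q
    have := h (Matrix.single p q 1)
    simp only [Matrix.trace, diag_apply] at this
    rw [this]
    simp [Matrix.single_apply, ite_and, eq_comm]
  change ∑ a : Fin l → m, ∑ i : Fin l → n, ∑ j : Fin l → n,
      X i j * ∏ t, Φ (Matrix.single (i t) (j t) 1) (a t) (a t) = ∑ i, X i i
  rw [Finset.sum_comm]
  refine Finset.sum_congr rfl fun i _ => ?_
  rw [Finset.sum_comm]
  have h2 : ∀ j : Fin l → n, ∑ a : Fin l → m, ∏ t, Φ (Matrix.single (i t) (j t) 1) (a t) (a t)
      = if i = j then 1 else 0 := by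
    intro j
    have := Fintype.prod_sum fun (t : Fin l) (c : m) => Φ (Matrix.single (i t) (j t) 1) c c
    rw [← this]
    simp only [h1, funext_iff]
    rw [Finset.prod_ite_zero]
    simp
  simp [← Finset.mul_sum, h2]

end Kraus

/-! ### The quantum Lovász function: finiteness, value at the full space, strict bound for proper
subspaces -/

section Lovasz

open scoped MatrixOrder Matrix.Norms.L2Operator

variable {n : Type*} [Fintype n]

/-- The partial trace over ℂ^n sends T ⊗ B to tr(T) B, and it is linear. -/
theorem sum_diag_eq_zero_of_mem_tensorFull {S : Submodule ℂ (Matrix n n ℂ)}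
    (hS : ∀ T ∈ S, T.trace = 0) {k : ℕ} {Z : Matrix (n × Fin k) (n × Fin k) ℂ}
    (hZ : Z ∈ tensorFull S k) (a b : Fin k) : ∑ p, Z (p, a) (p, b) = 0 := by
  induction hZ using Submodule.span_induction with
  | mem Z hZ =>
    obtain ⟨T, hT, B, rfl⟩ := hZ
    have := hS T hT
    simp only [kroneckerMap_apply, ← Finset.sum_mul]
    simp only [Matrix.trace, diag_apply] at this
    rw [this, zero_mul]
  | zero => simp
  | add X Y _ _ hX hY => simp [Finset.sum_add_distrib, hX, hY]
  | smul c X _ hX => simp [← Finset.mul_sum, hX]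

theorem conjTranspose_mem_hsOrthogonal {S : Submodule ℂ (Matrix n n ℂ)}
    (hS : ∀ X ∈ S, Xᴴ ∈ S) {T : Matrix n n ℂ} (hT : T ∈ hsOrthogonal S) :
    Tᴴ ∈ hsOrthogonal S := by
  intro X hX
  have h := hT Xᴴ (hS X hX)
  rw [conjTranspose_conjTranspose, Matrix.trace_mul_comm] at h
  rw [← conjTranspose_mul, trace_conjTranspose, h, star_zero]

variable [DecidableEq n]

theorem Matrix.PosSemidef.exists_eq_conjTranspose_mul_self {A : Matrix n n ℂ} (h : A.PosSemidef) :
    ∃ B : Matrix n n ℂ, A = Bᴴ * B :=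
  CStarAlgebra.nonneg_iff_eq_star_mul_self.1 (Matrix.nonneg_iff_posSemidef.2 h)

theorem Matrix.l2_opNorm_one_le : ‖(1 : Matrix n n ℂ)‖ ≤ 1 := by
  rw [← diagonal_one, l2_opNorm_diagonal]
  exact (pi_norm_le_iff_of_nonneg zero_le_one).2 fun _ => by simp

/-- `|p⟩ ⊗ 1`, as an operator from `ℂ^k` to `ℂ^n ⊗ ℂ^k`. -/
def ketTensorOne (k : Type*) [DecidableEq k] (p : n) : Matrix (n × k) k ℂ :=
  Matrix.of fun x y => if x = (p, y) then 1 else 0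

variable {k : Type*} [Fintype k] [DecidableEq k]

theorem ketTensorOne_conj_apply (A : Matrix (n × k) (n × k) ℂ) (p : n) (a b : k) :
    ((ketTensorOne k p)ᴴ * A * ketTensorOne k p) a b = A (p, a) (p, b) := by
  simp [ketTensorOne, Matrix.mul_apply, apply_ite (starRingEnd ℂ)]

theorem sum_ketTensorOne_mul : ∑ p : n, ketTensorOne k p * (ketTensorOne k p)ᴴ = 1 := by
  ext ⟨p, a⟩ ⟨q, b⟩
  simp [ketTensorOne, Matrix.sum_apply, Matrix.mul_apply, apply_ite (starRingEnd ℂ),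
    Matrix.one_apply, Prod.ext_iff, ite_and, eq_comm]

theorem l2_opNorm_ketTensorOne_le (p : n) : ‖ketTensorOne k p‖ ≤ 1 := by
  have h1 : (ketTensorOne k p)ᴴ * ketTensorOne k p = 1 := by
    ext a b
    simp [ketTensorOne, Matrix.mul_apply, apply_ite (starRingEnd ℂ), Matrix.one_apply,
      eq_comm]
  have h2 := l2_opNorm_conjTranspose_mul_self (ketTensorOne k p)
  rw [h1] at h2
  nlinarith [norm_nonneg (ketTensorOne k p), Matrix.l2_opNorm_one_le (n := k)]

/-- A positive operator on `ℂ^n ⊗ ℂ^k` whose partial trace over `ℂ^n` is `c 1` is bounded in terms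
of `c` and `n` only. -/
theorem l2_opNorm_le_of_partialTrace {A : Matrix (n × k) (n × k) ℂ} (hA : A.PosSemidef) {c : ℝ}
    (hc : 0 ≤ c)
    (h : ∑ p : n, (ketTensorOne k p)ᴴ * A * ketTensorOne k p = (c : ℂ) • (1 : Matrix k k ℂ)) :
    ‖A‖ ≤ (Fintype.card n * √c) ^ 2 := by
  obtain ⟨B, hB⟩ := hA.exists_eq_conjTranspose_mul_self
  -- Each diagonal block of A is positive, hence dominated by the sum of all blocks, which is c·1.
  have h1 : ∀ p : n, ‖B * ketTensorOne k p‖ ≤ √c := by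
    intro p
    have e1 : (B * ketTensorOne k p)ᴴ * (B * ketTensorOne k p)
        = (ketTensorOne k p)ᴴ * A * ketTensorOne k p := by
      rw [hB, conjTranspose_mul]; simp only [Matrix.mul_assoc]
    have e2 : ‖(ketTensorOne k p)ᴴ * A * ketTensorOne k p‖ ≤ ‖(c : ℂ) • (1 : Matrix k k ℂ)‖ := by
      refine CStarAlgebra.norm_le_norm_of_nonneg_of_le
        (Matrix.nonneg_iff_posSemidef.2 (hA.conjTranspose_mul_mul_same _)) ?_
      rw [← h]
      exact Finset.single_le_sum
        (f := fun p : n => (ketTensorOne k p)ᴴ * A * ketTensorOne k p)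
        (fun q _ => Matrix.nonneg_iff_posSemidef.2 (hA.conjTranspose_mul_mul_same _))
        (Finset.mem_univ p)
    rw [← e1, l2_opNorm_conjTranspose_mul_self, norm_smul, Complex.norm_real,
      Real.norm_of_nonneg hc] at e2
    refine Real.le_sqrt_of_sq_le ?_
    rw [sq]
    exact e2.trans (mul_le_of_le_one_right hc Matrix.l2_opNorm_one_le)
  -- Resolve the identity as ∑ |p⟩⟨p| ⊗ 1 and use the triangle inequality. The number of terms
  -- depends on n only.
  have h2 : ‖B‖ ≤ Fintype.card n * √c := by
    have : B = ∑ p : n, B * ketTensorOne k p * (ketTensorOne k p)ᴴ := by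
      simp only [Matrix.mul_assoc]
      rw [← Matrix.mul_sum, sum_ketTensorOne_mul, Matrix.mul_one]
    rw [this]
    refine (norm_sum_le _ _).trans ?_
    rw [← nsmul_eq_mul, ← Finset.card_univ]
    refine Finset.sum_le_card_nsmul _ _ _ fun p _ => ?_
    refine (l2_opNorm_mul _ _).trans ?_
    rw [l2_opNorm_conjTranspose]
    exact (mul_le_of_le_one_right (norm_nonneg _) (l2_opNorm_ketTensorOne_le p)).trans (h1 p)
  rw [hB, l2_opNorm_conjTranspose_mul_self, sq]
  exact mul_self_le_mul_self (norm_nonneg _) h2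

theorem trace_eq_zero_of_mem_hsOrthogonal {S : Submodule ℂ (Matrix n n ℂ)} (h1 : 1 ∈ S)
    {T : Matrix n n ℂ} (hT : T ∈ hsOrthogonal S) : T.trace = 0 := by
  simpa using hT 1 h1

/-- Since T is orthogonal to 1 in its first factor, 1 + T has the same partial trace as 1, namely
dim(ℂ^n)·1, whatever k is. -/
theorem bddAbove_lovaszValues {S : Submodule ℂ (Matrix n n ℂ)} (h1 : 1 ∈ S) :
    BddAbove (lovaszValues S) := by
  refine ⟨(Fintype.card n * √(Fintype.card n : ℝ)) ^ 2, ?_⟩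
  rintro _ ⟨k, -, T, hT, hpos, rfl⟩
  refine l2_opNorm_le_of_partialTrace hpos (Nat.cast_nonneg _) ?_
  ext a b
  have := sum_diag_eq_zero_of_mem_tensorFull
    (fun T hT => trace_eq_zero_of_mem_hsOrthogonal h1 hT) hT a b
  simp only [Matrix.sum_apply, ketTensorOne_conj_apply, Matrix.add_apply, Finset.sum_add_distrib,
    this]
  by_cases hab : a = b <;> simp [Matrix.one_apply, hab]

theorem lovaszTheta_top [Nonempty n] : lovaszTheta (⊤ : Submodule ℂ (Matrix n n ℂ)) = 1 := by
  have h0 : ∀ T ∈ hsOrthogonal (⊤ : Submodule ℂ (Matrix n n ℂ)), T = 0 := fun T hT =>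
    Matrix.trace_conjTranspose_mul_self_eq_zero_iff.1 (hT T trivial)
  have h1 : ∀ k : ℕ, tensorFull (hsOrthogonal (⊤ : Submodule ℂ (Matrix n n ℂ))) k = ⊥ := by
    intro k
    rw [tensorFull, Submodule.span_eq_bot]
    rintro _ ⟨T, hT, B, rfl⟩
    rw [h0 T hT]
    exact Matrix.zero_kronecker B
  have h2 : lovaszValues (⊤ : Submodule ℂ (Matrix n n ℂ)) = {1} := by
    ext r
    constructor
    · rintro ⟨k, hk, T, hT, -, rfl⟩
      rw [h1, Submodule.mem_bot] at hT
      -- For k = 0 the identity would have norm 0 instead of 1.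
      have : Nonempty (Fin k) := ⟨⟨0, hk⟩⟩
      simp [hT]
    · rintro rfl
      exact ⟨1, le_rfl, 0, zero_mem _, by simpa using Matrix.PosSemidef.one, by simp⟩
  rw [lovaszTheta, h2, csSup_singleton]

/-- Take a nonzero functional vanishing on S and represent it by a matrix through the
Hilbert–Schmidt pairing. -/
theorem exists_ne_zero_mem_hsOrthogonal {S : Submodule ℂ (Matrix n n ℂ)} (hS : S ≠ ⊤) :
    ∃ T ∈ hsOrthogonal S, T ≠ 0 := by
  obtain ⟨f, hf, hSf⟩ := S.exists_le_ker_of_lt_top hS.lt_top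
  have hsum : ∀ X, f X = ∑ p, ∑ q, X p q * f (Matrix.single p q 1) := by
    intro X
    conv_lhs => rw [Matrix.matrix_eq_sum_single X]
    simp only [map_sum, ← smul_eq_mul, ← map_smul, Matrix.smul_single]
    simp
  refine ⟨Matrix.of fun p q => star (f (Matrix.single p q 1)), fun X hX => ?_, fun h0 => hf ?_⟩
  · have h1 := congrArg star (hsum X)
    rw [show f X = 0 from hSf hX] at h1
    simp only [star_sum, star_mul', star_zero] at h1
    simp only [Matrix.trace, diag_apply, Matrix.mul_apply, conjTranspose_apply, of_apply]
    rw [Finset.sum_comm, ← h1]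
  · refine LinearMap.ext fun X => ?_
    rw [hsum]
    refine Finset.sum_eq_zero fun p _ => Finset.sum_eq_zero fun q _ => ?_
    have := congrFun (congrFun h0 p) q
    simp only [of_apply, Matrix.zero_apply, star_eq_zero] at this
    rw [this, mul_zero]

/-- S^⊥ inherits closure under adjoints, so T + T* works unless T is anti-Hermitian, in which case
iT does. -/
theorem exists_isHermitian_mem_hsOrthogonal {S : Submodule ℂ (Matrix n n ℂ)}
    (hstar : ∀ X ∈ S, Xᴴ ∈ S) (hS : S ≠ ⊤) : ∃ T ∈ hsOrthogonal S, T.IsHermitian ∧ T ≠ 0 := by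
  obtain ⟨T, hT, hT0⟩ := exists_ne_zero_mem_hsOrthogonal hS
  have hT' := conjTranspose_mem_hsOrthogonal hstar hT
  by_cases h : T + Tᴴ = 0
  · refine ⟨Complex.I • T, Submodule.smul_mem _ _ hT, ?_, ?_⟩
    · have : Tᴴ = -T := eq_neg_of_add_eq_zero_right h
      rw [Matrix.IsHermitian, conjTranspose_smul, this]
      simp
    · exact smul_ne_zero Complex.I_ne_zero hT0
  · exact ⟨T + Tᴴ, add_mem hT hT', isHermitian_add_transpose_self T, h⟩

/-- Scale a nonzero Hermitian element of S^⊥ to a matrix Y of norm 1, so that 1 + Y ≥ 0. If ‖1 + Y‖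
≤ 1, then Y ≤ 0, and as Y is traceless it would vanish. -/
theorem one_lt_lovaszTheta {S : Submodule ℂ (Matrix n n ℂ)} (h1 : 1 ∈ S)
    (hstar : ∀ X ∈ S, Xᴴ ∈ S) (hS : S ≠ ⊤) : 1 < lovaszTheta S := by
  obtain ⟨H, hH, hHh, hH0⟩ := exists_isHermitian_mem_hsOrthogonal hstar hS
  set Z : Matrix (n × Fin 1) (n × Fin 1) ℂ := H ⊗ₖ (1 : Matrix (Fin 1) (Fin 1) ℂ) with hZ
  have hZ0 : Z ≠ 0 := by
    intro h
    refine hH0 (Matrix.ext fun p q => ?_)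
    simpa [hZ] using congrFun (congrFun h (p, 0)) (q, 0)
  have hZh : IsSelfAdjoint Z := by
    change Zᴴ = Z
    rw [hZ, conjTranspose_kronecker, hHh.eq, conjTranspose_one]
  have hZt : Z.trace = 0 := by
    rw [hZ, trace_kronecker, trace_eq_zero_of_mem_hsOrthogonal h1 hH, zero_mul]
  have hZm : Z ∈ tensorFull (hsOrthogonal S) 1 := Submodule.subset_span ⟨H, hH, 1, rfl⟩
  have hn : 0 < ‖Z‖ := norm_pos_iff.2 hZ0
  obtain ⟨Y, hY⟩ : ∃ Y, Y = ((‖Z‖⁻¹ : ℝ) : ℂ) • Z := ⟨_, rfl⟩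
  have hYn : ‖Y‖ = 1 := by
    rw [hY, norm_smul, Complex.norm_real, Real.norm_of_nonneg (inv_nonneg.2 hn.le),
      inv_mul_cancel₀ hn.ne']
  have hYh : IsSelfAdjoint Y := by
    change Yᴴ = Y
    have : Zᴴ = Z := hZh
    rw [hY, conjTranspose_smul, this, Complex.star_def, Complex.conj_ofReal]
  have hY0 : Y ≠ 0 := by
    rw [← norm_pos_iff, hYn]; exact one_pos
  have hYt : Y.trace = 0 := by rw [hY, trace_smul, hZt, smul_zero]
  have hYpos : (1 + Y).PosSemidef := by
    have := IsSelfAdjoint.neg_algebraMap_norm_le_self (a := Y) hYh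
    rw [hYn, map_one, neg_le_iff_add_nonneg] at this
    rw [add_comm]
    exact Matrix.nonneg_iff_posSemidef.1 this
  have hlt : 1 < ‖1 + Y‖ := by
    by_contra! hle
    have h2 := IsSelfAdjoint.le_algebraMap_norm_self (a := 1 + Y) hYpos.1
    have h3 : algebraMap ℝ (Matrix (n × Fin 1) (n × Fin 1) ℂ) ‖1 + Y‖ ≤ 1 := by
      rw [← map_one (algebraMap ℝ (Matrix (n × Fin 1) (n × Fin 1) ℂ))]
      exact algebraMap_mono _ hle
    have h4 : (-Y).PosSemidef := by
      have h5 := h2.trans h3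
      rw [Matrix.le_iff] at h5
      simpa using h5
    refine hY0 (neg_eq_zero.1 (h4.trace_eq_zero_iff.1 ?_))
    rw [trace_neg, hYt, neg_zero]
  refine lt_of_lt_of_le hlt (le_csSup (bddAbove_lovaszValues h1) ?_)
  exact ⟨1, le_rfl, Y, hY ▸ Submodule.smul_mem _ _ hZm, hYpos, rfl⟩

end Lovasz

/-! ### Orthogonality of channel outputs and perfect discrimination -/

section Orthogonality

variable {a b ι : Type*} [Fintype a] [Fintype b] [Fintype ι]

/-- Writing the overlap of two outputs as a squared Hilbert–Schmidt norm shows that it is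
nonnegative and vanishes only if the operator inside does. -/
theorem trace_mul_conj_mul_conj (C F : Matrix a a ℂ) (G G' : Matrix b a ℂ) :
    (G * (Cᴴ * C) * Gᴴ * (G' * (Fᴴ * F) * G'ᴴ)).trace
      = ((C * Gᴴ * G' * Fᴴ) * (C * Gᴴ * G' * Fᴴ)ᴴ).trace := by
  have h : G * (Cᴴ * C) * Gᴴ * (G' * (Fᴴ * F) * G'ᴴ)
      = (G * Cᴴ) * ((C * Gᴴ * G' * Fᴴ) * (F * G'ᴴ)) := by simp only [Matrix.mul_assoc]
  rw [h, Matrix.trace_mul_comm]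
  simp only [conjTranspose_mul, conjTranspose_conjTranspose, Matrix.mul_assoc]

/-- If two channel outputs are orthogonal, then the inputs are not confusable. -/
theorem mul_kraus_mul_eq_zero [DecidableEq a] {A B : Matrix a a ℂ} (hA : A.PosSemidef)
    (hB : B.PosSemidef) {G : ι → Matrix b a ℂ}
    (h : ((∑ s, G s * A * (G s)ᴴ) * ∑ r, G r * B * (G r)ᴴ).trace = 0) (s r : ι) :
    A * ((G s)ᴴ * G r) * B = 0 := by
  obtain ⟨C, rfl⟩ := hA.exists_eq_conjTranspose_mul_self
  obtain ⟨F, rfl⟩ := hB.exists_eq_conjTranspose_mul_self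
  simp only [Matrix.sum_mul, Matrix.mul_sum, trace_sum, trace_mul_conj_mul_conj] at h
  have hnn : ∀ s r, 0 ≤ ((C * (G s)ᴴ * G r * Fᴴ) * (C * (G s)ᴴ * G r * Fᴴ)ᴴ).trace :=
    fun s r => (posSemidef_self_mul_conjTranspose _).trace_nonneg
  have h1 := (Finset.sum_eq_zero_iff_of_nonneg fun s _ => Finset.sum_nonneg fun r _ => hnn r s).1 h
    r (Finset.mem_univ _)
  have h2 := (Finset.sum_eq_zero_iff_of_nonneg fun q _ => hnn q r).1 h1 s (Finset.mem_univ _)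
  have h3 := trace_mul_conjTranspose_self_eq_zero_iff.1 h2
  calc Cᴴ * C * ((G s)ᴴ * G r) * (Fᴴ * F) = Cᴴ * (C * (G s)ᴴ * G r * Fᴴ) * F := by
        simp only [Matrix.mul_assoc]
    _ = 0 := by rw [h3]; simp

theorem Matrix.PosSemidef.trace_mul_nonneg [DecidableEq a] {A B : Matrix a a ℂ}
    (hA : A.PosSemidef) (hB : B.PosSemidef) : 0 ≤ (A * B).trace := by
  obtain ⟨C, rfl⟩ := hA.exists_eq_conjTranspose_mul_self
  rw [Matrix.mul_assoc, Matrix.trace_mul_comm]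
  exact (hB.mul_mul_conjTranspose_same C).trace_nonneg

theorem Matrix.PosSemidef.mul_eq_zero_of_trace [DecidableEq a] {A B : Matrix a a ℂ}
    (hA : A.PosSemidef) (hB : B.PosSemidef) (h : (A * B).trace = 0) : A * B = 0 := by
  have := mul_kraus_mul_eq_zero (ι := Unit) (G := fun _ => (1 : Matrix a a ℂ)) hA hB
    (by simpa using h) () ()
  simpa using this

/-- States that are identified with certainty by a measurement are orthogonal. -/
theorem mul_eq_zero_of_discriminated [DecidableEq a] {M : ℕ} {ρ D : Fin M → Matrix a a ℂ}
    (hρ : ∀ i, (ρ i).PosSemidef) (hρ1 : ∀ i, (ρ i).trace = 1) (hD : ∀ i, (D i).PosSemidef)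
    (hD1 : ∑ i, D i = 1) (h : ∀ i, (ρ i * D i).trace = 1) {i j : Fin M} (hij : j ≠ i) :
    ρ j * ρ i = 0 := by
  have h0 : ∀ i k, k ≠ i → ρ i * D k = 0 := by
    intro i k hk
    refine (hρ i).mul_eq_zero_of_trace (hD k) ?_
    have h1 : ∑ k, (ρ i * D k).trace = 1 := by
      rw [← trace_sum, ← Matrix.mul_sum, hD1, Matrix.mul_one, hρ1]
    rw [← Finset.add_sum_erase _ _ (Finset.mem_univ i), h i, add_eq_left] at h1
    exact (Finset.sum_eq_zero_iff_of_nonneg fun k _ => (hρ i).trace_mul_nonneg (hD k)).1 h1 k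
      (Finset.mem_erase.2 ⟨hk, Finset.mem_univ _⟩)
  have h1 : D j * ρ i = 0 := by
    have := congrArg conjTranspose (h0 i j hij)
    rwa [conjTranspose_mul, (hD j).1.eq, (hρ i).1.eq, conjTranspose_zero] at this
  -- All other effects annihilate ρ_j and the effects sum to 1.
  have h2 : ρ j = ρ j * D j := by
    conv_lhs => rw [← Matrix.mul_one (ρ j), ← hD1, Matrix.mul_sum]
    exact Finset.sum_eq_single j (fun k _ hk => h0 j k hk) (by simp)
  rw [h2, Matrix.mul_assoc, h1, Matrix.mul_zero]

end Orthogonality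

/-! ### A full confusability graph has no entanglement-assisted zero-error capacity -/

section Capacity

variable {n m : Type*}

/-- The operator `X₁ ⊗ ⋯ ⊗ X_l` on `(ℂ^n)^{⊗l}`, as a multilinear map. -/
def tensorOperators (n : Type*) (l : ℕ) : MultilinearMap ℂ (fun _ : Fin l => Matrix n n ℂ)
    (Matrix (Fin l → n) (Fin l → n) ℂ) :=
  MultilinearMap.pi fun a => MultilinearMap.pi fun b =>
    (MultilinearMap.mkPiAlgebra ℂ (Fin l) ℂ).compLinearMap fun t =>
      Matrix.entryLinearMap ℂ ℂ (a t) (b t)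

theorem tensorOperators_apply {l : ℕ} (X : Fin l → Matrix n n ℂ) (a b : Fin l → n) :
    tensorOperators n l X a b = ∏ t, X t (a t) (b t) := rfl

theorem tensorOperators_single [DecidableEq n] {l : ℕ} (p q : Fin l → n) :
    tensorOperators n l (fun t => Matrix.single (p t) (q t) 1) = Matrix.single p q 1 := by
  ext a b
  simp only [tensorOperators_apply, Matrix.single_apply, Finset.prod_ite_zero, funext_iff,
    forall_and, Finset.mem_univ, true_imp_iff, Finset.prod_const_one]

/-- `Y ↦ A (1 ⊗ Y) B`. -/
def ampliatedSandwich {k a : Type*} [Fintype k] [DecidableEq k] [Fintype a]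
    (A B : Matrix (k × a) (k × a) ℂ) : Matrix a a ℂ →ₗ[ℂ] Matrix (k × a) (k × a) ℂ where
  toFun Y := A * ((1 : Matrix k k ℂ) ⊗ₖ Y) * B
  map_add' Y Z := by rw [kronecker_add, Matrix.mul_add, Matrix.add_mul]
  map_smul' c Y := by
    rw [kronecker_smul, Matrix.mul_smul, Matrix.smul_mul, RingHom.id_apply]

theorem ampliatedSandwich_single_apply {k a : Type*} [Fintype k] [DecidableEq k] [Fintype a]
    [DecidableEq a] (A B : Matrix (k × a) (k × a) ℂ) (p q : a) (x y : k × a) :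
    ampliatedSandwich A B (Matrix.single p q 1) x y = ∑ z, A x (z, p) * B (z, q) y := by
  change (A * ((1 : Matrix k k ℂ) ⊗ₖ Matrix.single p q (1 : ℂ)) * B) x y = _
  simp only [Matrix.mul_apply, kroneckerMap_apply, Fintype.sum_prod_type, Matrix.one_apply,
    Matrix.single_apply]
  refine Finset.sum_congr rfl fun z _ => ?_
  rw [Finset.sum_eq_single q]
  · congr 1
    rw [Finset.sum_eq_single z, Finset.sum_eq_single p]
    · simp
    · intro c _ hc; simp [hc.symm]
    · simp
    · intro c _ hc; simp [hc]
    · simp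
  · intro c _ hc
    simp [hc.symm]
  · simp

variable [Fintype n] [Fintype m]

theorem partialTrace_idTensor {k : Type*} {Φ : SuperOp n m} (h : ∀ X, (Φ X).trace = X.trace)
    (X : Matrix (k × n) (k × n) ℂ) (x y : k) :
    ∑ a, idTensor k Φ X (x, a) (y, a) = ∑ q, X (x, q) (y, q) :=
  h (Matrix.of fun i j => X (x, i) (y, j))

theorem trace_idTensor {k : Type*} [Fintype k] {Φ : SuperOp n m}
    (h : ∀ X, (Φ X).trace = X.trace) (X : Matrix (k × n) (k × n) ℂ) :
    (idTensor k Φ X).trace = X.trace := by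
  simp only [Matrix.trace, diag_apply, Fintype.sum_prod_type, partialTrace_idTensor h]

/-- If the confusability graph is everything, then no two inputs of `Φ^{⊗l}` that have orthogonal
outputs exist, even in the presence of a reference system. -/
theorem ampliatedSandwich_eq_zero [DecidableEq n] {Φ : SuperOp n m}
    (hS : confusabilityGraph Φ = ⊤) {k : Type*} [Fintype k] [DecidableEq k] {l : ℕ}
    {A B : Matrix (k × (Fin l → n)) (k × (Fin l → n)) ℂ} (hA : A.PosSemidef)
    (hB : B.PosSemidef)
    (h : idTensor k (tensorPower Φ l) A * idTensor k (tensorPower Φ l) B = 0)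
    (p q : Fin l → n) : ampliatedSandwich A B (Matrix.single p q 1) = 0 := by
  -- A basis of B(ℂ^n) chosen among the generators E_j* E_i; a multilinear map need only be tested
  -- on it.
  let b := Module.Basis.ofSpan (le_of_eq hS.symm)
  have hb : ∀ i, b i ∈ {X : Matrix n n ℂ | ∃ (K : ℕ) (E : Fin K → Matrix m n ℂ),
      (∀ Y, Φ Y = ∑ i, E i * Y * (E i)ᴴ) ∧ ∃ i j, X = (E j)ᴴ * E i} :=
    fun i => Module.Basis.ofSpan_subset _ ⟨i, rfl⟩
  have h0 : (ampliatedSandwich A B).compMultilinearMap (tensorOperators n l) = 0 := by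
    refine Module.Basis.ext_multilinear (fun _ => b) fun v => ?_
    -- Each tensor position t has its own Kraus family; the product of the chosen generators is then
    -- G_s* G_r for Kraus operators of the tensor power.
    choose K E hE r s hrs using fun t => hb (v t)
    have hG := IsKraus.tensorPower (Φ := Φ) (E := E) hE
    have hX : tensorOperators n l (fun t => b (v t))
        = (Matrix.of fun a i => ∏ t, E t (s t) (a t) (i t) :
            Matrix (Fin l → m) (Fin l → n) ℂ)ᴴ
          * (Matrix.of fun a i => ∏ t, E t (r t) (a t) (i t) :
            Matrix (Fin l → m) (Fin l → n) ℂ) := by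
      ext i j
      simp only [tensorOperators_apply, hrs, Matrix.mul_apply, conjTranspose_apply, of_apply,
        star_prod, ← Finset.prod_mul_distrib]
      rw [Fintype.prod_sum]
    rw [hG.idTensor, hG.idTensor] at h
    have h1 := mul_kraus_mul_eq_zero hA hB (by rw [h, trace_zero]) s r
    rw [conjTranspose_kronecker, conjTranspose_one, ← mul_kronecker_mul, Matrix.one_mul] at h1
    change A * ((1 : Matrix k k ℂ) ⊗ₖ tensorOperators n l (fun t => b (v t))) * B = 0
    rw [hX, h1]
  have h2 := congrArg (fun f => f fun t => Matrix.single (p t) (q t) 1) h0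
  simpa [tensorOperators_single] using h2

variable [DecidableEq n] [DecidableEq m]

/-- Encoders are trace preserving, so all encoded states share the reduced state τ of σ on F'.
Perfect distinguishability of two messages would force τ² = 0, contradicting tr τ = 1. -/
theorem IsZeroErrorEACode.le_one {N : SuperOp n m} (hN : N ∈ channels n m)
    (hS : confusabilityGraph N = ⊤) {l M f : ℕ} {σ : Matrix (Fin f × Fin f) (Fin f × Fin f) ℂ}
    {P : Fin M → SuperOp (Fin f) (Fin l → n)}
    {D : Fin M → Matrix (Fin f × (Fin l → m)) (Fin f × (Fin l → m)) ℂ}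
    (hc : IsZeroErrorEACode N l M f σ P D) : M ≤ 1 := by
  by_contra! hM
  let i : Fin M := ⟨0, by omega⟩
  let j : Fin M := ⟨1, hM⟩
  have hij : j ≠ i := by simp [i, j]
  obtain ⟨K, E, hE⟩ := hN.1.exists_isKraus
  have hω : ∀ i, (idTensor (Fin f) (P i) σ).PosSemidef :=
    fun i => (hc.encoder_mem i).1 f σ hc.state_posSemidef
  have hcp : IsCompletelyPositive (tensorPower N l) :=
    (IsKraus.tensorPower (K := fun _ => K) (fun _ : Fin l => hE)).isCompletelyPositive
  have h0 : idTensor (Fin f) (tensorPower N l) (idTensor (Fin f) (P j) σ)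
      * idTensor (Fin f) (tensorPower N l) (idTensor (Fin f) (P i) σ) = 0 :=
    mul_eq_zero_of_discriminated
      (ρ := fun i => idTensor (Fin f) (tensorPower N l) (idTensor (Fin f) (P i) σ))
      (fun i => hcp f _ (hω i))
      (fun i => by
        rw [trace_idTensor (trace_tensorPower hN.2 l), trace_idTensor (hc.encoder_mem i).2,
          hc.state_trace])
      hc.povm_posSemidef hc.povm_sum hc.zero_error hij
  have h1 := ampliatedSandwich_eq_zero hS (hω j) (hω i) h0
  set τ : Matrix (Fin f) (Fin f) ℂ := Matrix.of fun x y => ∑ q, σ (x, q) (y, q) with hτ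
  have hτ' : ∀ i x y, ∑ a, idTensor (Fin f) (P i) σ (x, a) (y, a) = τ x y :=
    fun i x y => partialTrace_idTensor (hc.encoder_mem i).2 σ x y
  have hττ : τ * τ = 0 := by
    ext x y
    -- Inserting Y = |p⟩⟨q|, reading the block between p and q and summing traces out the channel
    -- input in both factors separately. What remains is an entry of τ·τ.
    have h2 : ∑ p, ∑ q, ampliatedSandwich (idTensor (Fin f) (P j) σ) (idTensor (Fin f) (P i) σ)
        (Matrix.single p q 1) (x, p) (y, q) = 0 := by simp [h1]
    simp only [ampliatedSandwich_single_apply] at h2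
    rw [Matrix.mul_apply, Matrix.zero_apply, ← h2]
    have h3 : ∀ z, τ x z * τ z y = ∑ p, ∑ q, idTensor (Fin f) (P j) σ (x, p) (z, p)
        * idTensor (Fin f) (P i) σ (z, q) (y, q) := by
      intro z
      rw [← hτ' j x z, ← hτ' i z y, Finset.sum_mul_sum]
    simp only [h3]
    rw [Finset.sum_comm]
    exact Finset.sum_congr rfl fun p _ => Finset.sum_comm
  have hτh : τᴴ = τ := by
    ext x y
    simp only [hτ, conjTranspose_apply, of_apply, star_sum]
    exact Finset.sum_congr rfl fun q _ => hc.state_posSemidef.1.apply _ _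
  have hτ0 : τ = 0 := by
    rw [← Matrix.trace_conjTranspose_mul_self_eq_zero_iff, hτh, hττ, trace_zero]
  have h3 : σ.trace = τ.trace := by
    simp [hτ, Matrix.trace, Fintype.sum_prod_type]
  have h4 := hc.state_trace
  rw [h3, hτ0, trace_zero] at h4
  exact zero_ne_one h4

theorem zeroErrorCapacityEA_eq_zero {N : SuperOp n m} (hN : N ∈ channels n m)
    (hS : confusabilityGraph N = ⊤) : zeroErrorCapacityEA N = 0 := by
  have h : ∀ l, maxMessagesEA l N ≤ 1 := by
    intro l
    refine csSup_le' ?_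
    rintro M ⟨f, σ, P, D, hc⟩
    exact hc.le_one hN hS
  have h1 : (fun l : ℕ => (1 / (l : ℝ)) * Real.logb 2 (maxMessagesEA l N)) = fun _ => 0 := by
    funext l
    have := h l
    -- The remaining values are 0 and 1; the logarithm is 0 for both, since `Real.logb 2 0 = 0`.
    interval_cases maxMessagesEA l N <;> simp
  rw [zeroErrorCapacityEA, h1]
  exact tendsto_const_nhds.limUnder_eq

end Capacity

/-! ### Relative interiors of convex sets -/

section RelativeInterior

/-- The line through x and y stays in the affine hull, where a neighbourhood of x lies in C; so it
can be followed a little beyond x, away from y. -/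
theorem exists_lineMap_mem_of_mem_intrinsicInterior {V : Type*} [NormedAddCommGroup V]
    [NormedSpace ℝ V] {C : Set V} {x y : V} (hx : x ∈ intrinsicInterior ℝ C) (hy : y ∈ C) :
    ∃ t : ℝ, t < 0 ∧ AffineMap.lineMap x y t ∈ C := by
  obtain ⟨x', hx', rfl⟩ := mem_intrinsicInterior.1 hx
  let y' : affineSpan ℝ C := ⟨y, subset_affineSpan ℝ C hy⟩
  have : Nonempty (affineSpan ℝ C) := ⟨y'⟩
  let g : ℝ → affineSpan ℝ C := fun t =>
    ⟨AffineMap.lineMap (x' : V) y t, AffineMap.lineMap_mem t x'.2 y'.2⟩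
  have hg : Continuous g := Continuous.subtype_mk AffineMap.lineMap_continuous _
  have hg0 : g 0 = x' := Subtype.ext (AffineMap.lineMap_apply_zero _ _)
  have h1 : ∀ᶠ t in 𝓝 (0 : ℝ), g t ∈ interior ((↑) ⁻¹' C : Set (affineSpan ℝ C)) :=
    hg.continuousAt.eventually_mem (by rw [hg0]; exact isOpen_interior.mem_nhds hx')
  obtain ⟨t, ht, ht0⟩ := ((h1.filter_mono nhdsWithin_le_nhds).and
    (self_mem_nhdsWithin (a := (0 : ℝ)) (s := Set.Iio 0))).exists
  exact ⟨t, ht0, interior_subset (s := ((↑) ⁻¹' C : Set (affineSpan ℝ C))) ht⟩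

/-- The homothety with centre y and ratio 1/t takes the point back to x. The preimage of the
interior under it is an open set, contained in C by convexity. -/
theorem Convex.lineMap_mem_intrinsicInterior {V : Type*} [NormedAddCommGroup V]
    [NormedSpace ℝ V] {C : Set V} (hC : Convex ℝ C) {x y : V} (hx : x ∈ intrinsicInterior ℝ C)
    (hy : y ∈ C) {t : ℝ} (ht : 0 < t) (ht1 : t ≤ 1) :
    AffineMap.lineMap y x t ∈ intrinsicInterior ℝ C := by
  obtain ⟨x', hx', rfl⟩ := mem_intrinsicInterior.1 hx
  have hyA := subset_affineSpan ℝ C hy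
  let g : affineSpan ℝ C → affineSpan ℝ C := fun z =>
    ⟨AffineMap.lineMap y (z : V) t⁻¹, AffineMap.lineMap_mem _ hyA z.2⟩
  have hg : Continuous g := by
    refine Continuous.subtype_mk ?_ _
    simp only [AffineMap.lineMap_apply_module]
    fun_prop
  let z : affineSpan ℝ C := ⟨AffineMap.lineMap y (x' : V) t, AffineMap.lineMap_mem _ hyA x'.2⟩
  have hgz : g z = x' := by
    refine Subtype.ext ?_
    simp only [g, z, AffineMap.lineMap_apply, vsub_eq_sub, vadd_eq_add, add_sub_cancel_right,
      smul_smul, inv_mul_cancel₀ ht.ne', one_smul, sub_add_cancel]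
  refine mem_intrinsicInterior.2 ⟨z, mem_interior.2 ⟨g ⁻¹' interior ((↑) ⁻¹' C), ?_,
    isOpen_interior.preimage hg, ?_⟩, rfl⟩
  · intro w hw
    have hw' : (g w : V) ∈ C := interior_subset (s := ((↑) ⁻¹' C : Set (affineSpan ℝ C))) hw
    have : (w : V) = AffineMap.lineMap y (g w : V) t := by
      simp only [g, AffineMap.lineMap_apply, vsub_eq_sub, vadd_eq_add, add_sub_cancel_right,
        smul_smul, mul_inv_cancel₀ ht.ne', one_smul, sub_add_cancel]
    change (w : V) ∈ C
    rw [this]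
    exact hC.lineMap_mem hy hw' ⟨ht.le, ht1⟩
  · rwa [Set.mem_preimage, hgz]

theorem Convex.subset_closure_intrinsicInterior {V : Type*} [NormedAddCommGroup V]
    [NormedSpace ℝ V] [FiniteDimensional ℝ V] {C : Set V} (hC : Convex ℝ C) :
    C ⊆ closure (intrinsicInterior ℝ C) := by
  intro y hy
  obtain ⟨x, hx⟩ := Set.Nonempty.intrinsicInterior hC ⟨y, hy⟩
  have h1 : Tendsto (fun t : ℝ => AffineMap.lineMap y x t) (𝓝[>] 0) (𝓝 y) := by
    have := (AffineMap.lineMap_continuous (R := ℝ) (p := y) (q := x)).tendsto 0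
    rw [AffineMap.lineMap_apply_zero] at this
    exact this.mono_left nhdsWithin_le_nhds
  refine mem_closure_of_tendsto h1 ?_
  filter_upwards [Ioc_mem_nhdsGT (zero_lt_one (α := ℝ))] with t ht
  exact hC.lineMap_mem_intrinsicInterior hx hy ht.1 ht.2

end RelativeInterior

/-! ### The convex set of channels and the depolarizing channel -/

section Channels

variable {n m : Type*} [Fintype n] [Fintype m]

/-- Into the zero space every output has trace 0, while the identity has trace dim ℂ^n ≠ 0. This
makes the depolarizing channel available. -/
theorem nonempty_of_mem_channels [DecidableEq n] [Nonempty n] {N : SuperOp n m} (hN : N ∈ channels n m) :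
    Nonempty m := by
  by_contra h
  rw [not_nonempty_iff] at h
  have h1 := hN.2 1
  rw [Matrix.trace_one, Matrix.trace, Fintype.sum_empty] at h1
  exact Fintype.card_ne_zero (Nat.cast_eq_zero.1 h1.symm)

theorem convex_channels [DecidableEq n] [DecidableEq m] : Convex ℝ (channels n m) := by
  intro Φ hΦ Ψ hΨ a b ha hb hab
  refine ⟨fun k X hX => ?_, fun X => ?_⟩
  · have : idTensor (Fin k) (a • Φ + b • Ψ) X
        = a • idTensor (Fin k) Φ X + b • idTensor (Fin k) Ψ X := by ext x y; rfl
    rw [this]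
    exact ((hΦ.1 k X hX).smul ha).add ((hΨ.1 k X hX).smul hb)
  · have : (a • Φ + b • Ψ) X = a • Φ X + b • Ψ X := rfl
    rw [this, trace_add, trace_smul, trace_smul, hΦ.2, hΨ.2, ← add_smul, hab, one_smul]

/-- The completely depolarizing channel `X ↦ tr(X) 1 / dim`. -/
noncomputable def depolarizing (n m : Type*) [Fintype n] [Fintype m] [DecidableEq m] :
    SuperOp n m :=
  (Matrix.traceLinearMap n ℂ ℂ).smulRight ((Fintype.card m : ℂ)⁻¹ • 1)

variable [DecidableEq n] [DecidableEq m]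

theorem isKraus_depolarizing : IsKraus (depolarizing n m) fun r : m × n =>
    (((√(Fintype.card m : ℝ))⁻¹ : ℝ) : ℂ) • Matrix.single r.1 r.2 1 := by
  refine isKraus_of_single fun p q i j => ?_
  have h : (((√(Fintype.card m : ℝ))⁻¹ : ℝ) : ℂ) * (((√(Fintype.card m : ℝ))⁻¹ : ℝ) : ℂ)
      = (Fintype.card m : ℂ)⁻¹ := by
    rw [← Complex.ofReal_mul, ← mul_inv, Real.mul_self_sqrt (Nat.cast_nonneg _)]
    simp
  have h1 : depolarizing n m (Matrix.single p q 1) i j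
      = (if p = q then 1 else 0) * ((Fintype.card m : ℂ)⁻¹ * if i = j then 1 else 0) := by
    by_cases hpq : p = q <;>
      simp [depolarizing, Matrix.one_apply, hpq]
  rw [h1, ← h]
  simp only [Fintype.sum_prod_type, Matrix.smul_apply, Matrix.single_apply, smul_eq_mul, star_mul',
    Complex.star_def, Complex.conj_ofReal]
  rw [Finset.sum_eq_single i, Finset.sum_eq_single p]
  · by_cases hpq : p = q <;> by_cases hij : i = j <;> simp [hpq, hij]
  · intro c _ hc; simp [hc]
  · simp
  · intro c _ hc; simp [hc]
  · simp

theorem depolarizing_mem_channels [Nonempty m] : depolarizing n m ∈ channels n m := by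
  refine ⟨isKraus_depolarizing.isCompletelyPositive, fun X => ?_⟩
  simp [depolarizing]

/-- A channel with a depolarizing component has a full confusability graph. -/
theorem confusabilityGraph_eq_top_of_add [Nonempty m] {N Φ : SuperOp n m}
    (hΦ : IsCompletelyPositive Φ) {a b : ℝ} (ha : 0 ≤ a) (hb : 0 < b)
    (h : N = a • Φ + b • depolarizing n m) : confusabilityGraph N = ⊤ := by
  obtain ⟨K, E, hE⟩ := hΦ.exists_isKraus
  set c : ℂ := ((√b : ℝ) : ℂ) * (((√(Fintype.card m : ℝ))⁻¹ : ℝ) : ℂ) with hc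
  have hsq : ∀ {a : ℝ}, 0 ≤ a → ∀ (F : Matrix m n ℂ) (Y : Matrix n n ℂ),
      (((√a : ℝ) : ℂ) • F) * Y * (((√a : ℝ) : ℂ) • F)ᴴ = a • (F * Y * Fᴴ) := by
    intro a ha F Y
    rw [conjTranspose_smul, Matrix.smul_mul, Matrix.smul_mul, Matrix.mul_smul, smul_smul,
      Complex.star_def, Complex.conj_ofReal, ← Complex.ofReal_mul, Real.mul_self_sqrt ha]
    rfl
  have hN : IsKraus N (Sum.elim (fun r => ((√a : ℝ) : ℂ) • E r)
      fun r : m × n => ((√b : ℝ) : ℂ) • ((((√(Fintype.card m : ℝ))⁻¹ : ℝ) : ℂ) •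
        Matrix.single r.1 r.2 1)) := by
    intro Y
    have : N Y = a • Φ Y + b • depolarizing n m Y := by rw [h]; rfl
    rw [this, hE Y, isKraus_depolarizing Y, Fintype.sum_sum_type]
    simp only [Sum.elim_inl, Sum.elim_inr, hsq ha, hsq hb.le, Finset.smul_sum]
  have hc0 : c ≠ 0 := by
    have h1 : √b ≠ 0 := (Real.sqrt_pos.2 hb).ne'
    have h2 : √(Fintype.card m : ℝ) ≠ 0 :=
      (Real.sqrt_pos.2 (Nat.cast_pos.2 Fintype.card_pos)).ne'
    exact mul_ne_zero (Complex.ofReal_ne_zero.2 h1) (Complex.ofReal_ne_zero.2 (inv_ne_zero h2))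
  obtain ⟨i⟩ := ‹Nonempty m›
  have hs : ∀ p q : n, Matrix.single p q (1 : ℂ) ∈ confusabilityGraph N := by
    intro p q
    -- One fixed output vector i suffices: (|i⟩⟨p|)* |i⟩⟨q| = |p⟩⟨q|.
    have h1 := hN.mem_confusabilityGraph (Sum.inr (i, q)) (Sum.inr (i, p))
    simp only [Sum.elim_inr, smul_smul, ← hc, conjTranspose_smul, Matrix.smul_mul,
      Matrix.mul_smul, conjTranspose_single, star_one, single_mul_single_same, mul_one] at h1
    have h2 : c * star c ≠ 0 := mul_ne_zero hc0 (star_ne_zero.2 hc0)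
    exact (Submodule.smul_mem_iff _ h2).1 h1
  refine eq_top_iff.2 fun X _ => ?_
  rw [Matrix.matrix_eq_sum_single X]
  refine sum_mem fun p _ => sum_mem fun q _ => ?_
  have : Matrix.single p q (X p q) = X p q • Matrix.single p q (1 : ℂ) := by
    rw [Matrix.smul_single, smul_eq_mul, mul_one]
  rw [this]
  exact Submodule.smul_mem _ _ (hs p q)

/-- The diamond norm makes `SuperOp n m` a real normed space for the pointwise real scalar
multiplication. -/
@[reducible]
noncomputable def SuperOp.realNormedSpace (n m : Type*) [Fintype n] [Fintype m] [DecidableEq n]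
    [DecidableEq m] : NormedSpace ℝ (SuperOp n m) where
  toModule := LinearMap.module
  norm_smul_le r Φ := by
    have h : r • Φ = (r : ℂ) • Φ := by
      ext X i j
      change r • Φ X i j = (r : ℂ) • Φ X i j
      simp
    have h1 := norm_smul_le (r : ℂ) Φ
    rwa [← h, Complex.norm_real] at h1

theorem dense_intrinsicInterior_channels :
    Dense {N : channels n m | (N : SuperOp n m) ∈ intrinsicInterior ℝ (channels n m)} := by
  have hfin : Module.Finite ℝ (SuperOp n m) := Module.Finite.trans ℂ (SuperOp n m)
  have h := @Convex.subset_closure_intrinsicInterior (SuperOp n m) _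
    (SuperOp.realNormedSpace n m) hfin _ convex_channels
  intro N
  rw [closure_subtype]
  refine closure_mono (fun x hx => ?_) (h N.2)
  exact ⟨⟨x, intrinsicInterior_subset hx⟩, hx, rfl⟩

theorem confusabilityGraph_eq_top_of_mem_intrinsicInterior [Nonempty n] {N : SuperOp n m}
    (hN : N ∈ intrinsicInterior ℝ (channels n m)) : confusabilityGraph N = ⊤ := by
  have := nonempty_of_mem_channels (intrinsicInterior_subset hN)
  obtain ⟨t, ht, hΦ⟩ := @exists_lineMap_mem_of_mem_intrinsicInterior (SuperOp n m) _
    (SuperOp.realNormedSpace n m) _ _ _ hN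
    (depolarizing_mem_channels (n := n) (m := m))
  set Φ := AffineMap.lineMap N (depolarizing n m) t with hΦdef
  have h1 : 0 < 1 - t := by linarith
  -- Solve Φ = (1 - t) N + t·(depolarizing) for N; as t < 0, both coefficients are positive.
  refine confusabilityGraph_eq_top_of_add hΦ.1 (a := (1 - t)⁻¹) (b := (1 - t)⁻¹ * -t)
    (inv_nonneg.2 h1.le) (mul_pos (inv_pos.2 h1) (neg_pos.2 ht)) ?_
  rw [hΦdef, AffineMap.lineMap_apply_module, smul_add, smul_smul, inv_mul_cancel₀ h1.ne', one_smul,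
    smul_smul, add_assoc, ← add_smul, mul_neg, add_neg_cancel, zero_smul, add_zero]

end Channels

/-! ### The main theorem -/

theorem mainTheorem11 {n m : Type*} [Fintype n] [DecidableEq n] [Nonempty n]
    [Fintype m] [DecidableEq m] :
    (∀ N ∈ channels n m, BddAbove (lovaszValues (confusabilityGraph N))) ∧
    Dense {N : channels n m | (N : SuperOp n m) ∈ intrinsicInterior ℝ (channels n m)} ∧
    (∀ N ∈ intrinsicInterior ℝ (channels n m),
      confusabilityGraph N = ⊤ ∧ lovaszTheta (confusabilityGraph N) = 1) ∧
    (∀ N : channels n m, 0 < zeroErrorCapacityEA (N : SuperOp n m) →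
      ¬ ContinuousAt
        (fun N' : channels n m => lovaszTheta (confusabilityGraph (N' : SuperOp n m))) N) := by
  have hri : ∀ N ∈ intrinsicInterior ℝ (channels n m),
      confusabilityGraph N = ⊤ ∧ lovaszTheta (confusabilityGraph N) = 1 := by
    intro N hN
    have h := confusabilityGraph_eq_top_of_mem_intrinsicInterior hN
    exact ⟨h, by rw [h, lovaszTheta_top]⟩
  refine ⟨fun N hN => bddAbove_lovaszValues (one_mem_confusabilityGraph hN), dense_intrinsicInterior_channels, hri,
    fun N hN hcont => ?_⟩
  have hS : confusabilityGraph (N : SuperOp n m) ≠ ⊤ := fun h =>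
    hN.ne' (zeroErrorCapacityEA_eq_zero N.2 h)
  have h1 := one_lt_lovaszTheta (one_mem_confusabilityGraph N.2)
    (fun X hX => conjTranspose_mem_confusabilityGraph hX) hS
  -- Continuity would keep the value above 1 near N, but by density relative interior points, where
  -- it equals 1, occur in every neighbourhood.
  have h2 := hcont.eventually (lt_mem_nhds h1)
  obtain ⟨N', hN', hN'1⟩ := (mem_closure_iff_frequently.1 (dense_intrinsicInterior_channels N)).and_eventually h2 |>.exists
  exact hN'1.ne' (hri N' hN').2
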